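/- Let $n\ge 0$, let $\mathcal X$ be a measurable space, and let $P(\cdot\mid x)$, $x=(x_1,\dots,x_n)\in\mathcal X^n$, be a conditional distribution (Markov kernel) of the label vector $Y\in\{0,1\}^n$ given $x$. For a prediction $\hat y$ and actual labels $y$ in $\{0,1\}^n$ let $\mathrm{TP}=\sum_i\hat y_iy_i$, $\mathrm{TN}=\sum_i(1-\hat y_i)(1-y_i)$, $\mathrm{PP}=\sum_i\hat y_i$, $\mathrm{AP}=\sum_i y_i$, and let $$\mathrm{metric}(\hat y,y)=\sum_j\frac{a_j\mathrm{TP}+b_j\mathrm{TN}+f_j(\mathrm{PP},\mathrm{AP})}{g_j(\mathrm{PP},\mathrm{AP})}$$ (a finite sum) with real constants $a_j,b_j$ and real functions $f_j,g_j$ ($g_j\neq 0$ on $\{0,\dots,n\}^2$). Assume the natural requirement $\mathrm{metric}(y,y)>\mathrm{metric}(y,y')$ for all $y'\neq y$. For $h:\mathcal X^n\times\{0,1\}^n\to\mathbb R$ let $$AL_h(x,y)=\max_{\mathcal Q}\min_{\mathcal P}\ \mathbb E_{\hat Y\sim\mathcal P,\ \check Y\sim\mathcal Q}\big[-\mathrm{metric}(\hat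 Y,\check Y)+h(x,\check Y)-h(x,y)\big]$$ be the adversarial prediction surrogate loss, where $\mathcal P,\mathcal Q$ range over all probability distributions on $\{0,1\}^n$. Let $\mathcal H$ be the set of functions that are additive over samples and the sum statistic, $$h(x,y)=\sum_{i=1}^n\sum_{k=0}^n\rho_{i,k}(x_i,y_i)\,\mathbf 1\big[\textstyle\sum_{i'} y_{i'}=k\big],$$ with every $\rho_{i,k}:\mathcal X\times\{0,1\}\to\mathbb R$ ranging over all measurable functions. For $x\in\mathcal X^n$ let $\mathcal H^*_x=\operatorname{argmin}_{h\in\mathcal H}\mathbb E_{Y\sim P(\cdot\mid x)}[AL_h(x,Y)]$ and $\mathcal Y^\diamond_x=\operatorname{argmax}_{y'}\mathbb E_{Y\sim P(\cdot\mid x)}[\mathrm{metric}(y',Y)]$. Then adversarial prediction over $\mathcal H$ is Fisher consistent, in the following sense, for every $x\in\mathcal X^n$. (i) The minimum over $\mathcal H$ is attained, and some $h^*\in\mathcal H^*_x$ satisfies $\operatorname{argmax}_y h^*(x,y)\subseteq\mathcal Y^\diamond_x$. (ii) If the Bayes-optimal prediction is unique, $\mathcal Y^\diamond_x=\{y^\diamond\}$,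 and $P(y^\diamond\mid x)>0$, then every $h^*\in\mathcal H^*_x$ satisfies $\operatorname{argmax}_y h^*(x,y)\subseteq\mathcal Y^\diamond_x$. -/

import Mathlib

open MeasureTheory ProbabilityTheory

namespace AdversarialPrediction

/-- Label vectors in `{0,1}ⁿ`; `true` is the positive label. -/
abbrev Labels (n : ℕ) : Type := Fin n → Bool

/-- Number of positive entries (`PP` for a prediction, `AP` for the actual labels). -/
def numPos {n : ℕ} (y : Labels n) : ℕ :=
  (Finset.univ.filter fun i => y i = true).card

/-- True positives of the prediction `p` against the actual labels `y`. -/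
def truePos {n : ℕ} (p y : Labels n) : ℕ :=
  (Finset.univ.filter fun i => p i = true ∧ y i = true).card

/-- True negatives of the prediction `p` against the actual labels `y`. -/
def trueNeg {n : ℕ} (p y : Labels n) : ℕ :=
  (Finset.univ.filter fun i => p i = false ∧ y i = false).card

/-- The performance metric `∑ⱼ (aⱼ TP + bⱼ TN + fⱼ(PP, AP)) / gⱼ(PP, AP)`;
the prediction is the first label vector, the actual labels are the second. -/
noncomputable def fracMetric {n : ℕ} {J : Type*} [Fintype J] (a b : J → ℝ)
    (f g : J → ℕ → ℕ → ℝ) (p y : Labels n) : ℝ :=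
  ∑ j, (a j * truePos p y + b j * trueNeg p y + f j (numPos p) (numPos y)) /
    g j (numPos p) (numPos y)

/-- Potential functions `h(x, y)` on sample vectors and label vectors. -/
abbrev Potential (𝒳 : Type*) (n : ℕ) : Type _ := (Fin n → 𝒳) → Labels n → ℝ

/-- Potentials additive over samples and the sum statistic:
`h(x, y) = ∑ᵢ ∑ₖ ρᵢₖ(xᵢ, yᵢ) 1[∑ y = k]` for `k = 0, …, n`, with every `ρᵢₖ` measurable. -/
def additivePotentials (𝒳 : Type*) [MeasurableSpace 𝒳] (n : ℕ) : Set (Potential 𝒳 n) :=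
  {h | ∃ ρ : Fin n → Fin (n + 1) → 𝒳 × Bool → ℝ, (∀ i k, Measurable (ρ i k)) ∧
    ∀ x y, h x y = ∑ i, ∑ k : Fin (n + 1),
      ρ i k (x i, y i) * (if numPos y = (k : ℕ) then 1 else 0)}

/-- The adversarial surrogate loss
`AL_h(x, y) = max_Q min_P E_{Ŷ ∼ P, Y̌ ∼ Q} [-metric(Ŷ, Y̌) + h(x, Y̌) - h(x, y)]`,
where `P` and `Q` range over all probability vectors on `{0,1}ⁿ`. -/
noncomputable def advLoss {𝒳 : Type*} {n : ℕ} (metric : Labels n → Labels n → ℝ)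
    (h : Potential 𝒳 n) (x : Fin n → 𝒳) (y : Labels n) : ℝ :=
  ⨆ Q : stdSimplex ℝ (Labels n), ⨅ P : stdSimplex ℝ (Labels n),
    ∑ u : Labels n, ∑ v : Labels n, P.1 u * Q.1 v * (-metric u v + h x v - h x y)

/-- The conditional risk `E_{Y ∼ P(· | x)} [AL_h(x, Y)]`. -/
noncomputable def condRisk {𝒳 : Type*} [MeasurableSpace 𝒳] {n : ℕ}
    (metric : Labels n → Labels n → ℝ) (P : Kernel (Fin n → 𝒳) (Labels n))
    (x : Fin n → 𝒳) (h : Potential 𝒳 n) : ℝ :=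
  ∫ y, advLoss metric h x y ∂(P x)

/-- The elements of the class `H` that minimize the conditional risk at `x` over `H`. -/
def riskMinimizers {𝒳 : Type*} [MeasurableSpace 𝒳] {n : ℕ}
    (metric : Labels n → Labels n → ℝ) (P : Kernel (Fin n → 𝒳) (Labels n))
    (H : Set (Potential 𝒳 n)) (x : Fin n → 𝒳) : Set (Potential 𝒳 n) :=
  {h | h ∈ H ∧ ∀ h' ∈ H, condRisk metric P x h ≤ condRisk metric P x h'}

/-- The set of maximizers of a function. -/
def argmaxSet {α : Type*} (φ : α → ℝ) : Set α := {y | ∀ y', φ y' ≤ φ y}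

/-- The Bayes-optimal predictions at `x`: the maximizers of `E_{Y ∼ P(· | x)} [metric(y', Y)]`. -/
noncomputable def bayesOptimal {𝒳 : Type*} [MeasurableSpace 𝒳] {n : ℕ}
    (metric : Labels n → Labels n → ℝ) (P : Kernel (Fin n → 𝒳) (Labels n))
    (x : Fin n → 𝒳) : Set (Labels n) :=
  argmaxSet fun y' => ∫ y, metric y' y ∂(P x)

end AdversarialPrediction

namespace AdversarialPrediction

open Filter Topology

section Game

variable {α : Type*} [Fintype α]

/-! Write `m` for the metric, `p` for the label distribution at `x`, and `w` for a Bayes-optimal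
prediction. Letting the adversary play `Q = p` bounds every conditional risk below by minus the
Bayes value (`le_gameValue_of_best_response`). The potential `m w` attains this bound, since the
predictor can answer with the point mass at `w` (`gameValue_self_le_zero`). It lies in the class
(`fracMetric_mem_additivePotentials`), and by the requirement on the metric its only maximizer is
`w`; this gives (i).

For (ii), any minimizer attains the same bound, so moving mass from `w` to `y` in the adversary's
`p` cannot raise the guaranteed payoff. The resulting first-order inequality (`potential_gap_le`)
makes the potential strictly smaller at `y ≠ w`. -/

/-- The payoff of the matrix game `c` under mixed strategies `P` and `Q`. -/
def payoff (c : α → α → ℝ) (Q P : stdSimplex ℝ α) : ℝ :=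
  ∑ u, ∑ v, P.1 u * Q.1 v * c u v

/-- The max-min value of the matrix game `c`. -/
noncomputable def gameValue (c : α → α → ℝ) : ℝ :=
  ⨆ Q : stdSimplex ℝ α, ⨅ P : stdSimplex ℝ α, payoff c Q P

theorem abs_payoff_le (c : α → α → ℝ) (Q P : stdSimplex ℝ α) :
    |payoff c Q P| ≤ ∑ u, ∑ v, |c u v| := by
  refine (Finset.abs_sum_le_sum_abs _ _).trans (Finset.sum_le_sum fun u _ => ?_)
  refine (Finset.abs_sum_le_sum_abs _ _).trans (Finset.sum_le_sum fun v _ => ?_)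
  have hP := mem_Icc_of_mem_stdSimplex P.2 u
  have hQ := mem_Icc_of_mem_stdSimplex Q.2 v
  rw [abs_mul, abs_of_nonneg (mul_nonneg hP.1 hQ.1)]
  exact mul_le_of_le_one_left (abs_nonneg _) (mul_le_one₀ hP.2 hQ.1 hQ.2)

theorem bddBelow_payoff (c : α → α → ℝ) (Q : stdSimplex ℝ α) :
    BddBelow (Set.range (payoff c Q)) :=
  ⟨-∑ u, ∑ v, |c u v|, by rintro _ ⟨P, rfl⟩; exact (abs_le.1 (abs_payoff_le c Q P)).1⟩

theorem payoff_sub_const (c : α → α → ℝ) (t : ℝ) (Q P : stdSimplex ℝ α) :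
    payoff (fun u v => c u v - t) Q P = payoff c Q P - t := by
  have h : ∑ u, ∑ v, P.1 u * Q.1 v * t = t := by
    simp_rw [← Finset.sum_mul, ← Finset.mul_sum, Q.2.2, mul_one, P.2.2, one_mul]
  simp only [payoff, mul_sub, Finset.sum_sub_distrib, h]

variable [Nonempty α]

instance : Nonempty (stdSimplex ℝ α) := by
  classical
  exact ⟨⟨_, single_mem_stdSimplex ℝ (Classical.arbitrary α)⟩⟩

theorem bddAbove_iInf_payoff (c : α → α → ℝ) :
    BddAbove (Set.range fun Q => ⨅ P, payoff c Q P) := by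
  refine ⟨∑ u, ∑ v, |c u v|, ?_⟩
  rintro _ ⟨Q, rfl⟩
  exact (ciInf_le (bddBelow_payoff c Q) (Classical.arbitrary _)).trans
    (abs_le.1 (abs_payoff_le c Q _)).2

theorem gameValue_le {c : α → α → ℝ} {t : ℝ} (P : stdSimplex ℝ α)
    (h : ∀ Q, payoff c Q P ≤ t) : gameValue c ≤ t :=
  ciSup_le fun Q => (ciInf_le (bddBelow_payoff c Q) P).trans (h Q)

theorem le_gameValue {c : α → α → ℝ} {t : ℝ} (Q : stdSimplex ℝ α)
    (h : ∀ P, t ≤ payoff c Q P) : t ≤ gameValue c :=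
  le_ciSup_of_le (bddAbove_iInf_payoff c) Q (le_ciInf h)

theorem gameValue_sub_const (c : α → α → ℝ) (t : ℝ) :
    gameValue (fun u v => c u v - t) = gameValue c - t := by
  simp only [gameValue, payoff_sub_const]
  rw [ciSup_sub (bddAbove_iInf_payoff c)]
  congr 1
  ext Q
  rw [ciInf_sub (bddBelow_payoff c Q)]

/-- If `w` is a best response to `Q`, the game with payoff `-m + φ` is worth at least
the expectation of `φ - m w` under `Q`. -/
theorem le_gameValue_of_best_response (m : α → α → ℝ) (φ : α → ℝ) (Q : stdSimplex ℝ α) (w : α)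
    (hw : ∀ u, ∑ v, Q.1 v * m u v ≤ ∑ v, Q.1 v * m w v) :
    ∑ v, Q.1 v * φ v - ∑ v, Q.1 v * m w v ≤ gameValue fun u v => -m u v + φ v := by
  refine le_gameValue Q fun P => ?_
  have h1 : payoff (fun u v => -m u v + φ v) Q P
      = ∑ u, P.1 u * (∑ v, Q.1 v * φ v - ∑ v, Q.1 v * m u v) := by
    refine Finset.sum_congr rfl fun u _ => ?_
    rw [← Finset.sum_sub_distrib, Finset.mul_sum]
    exact Finset.sum_congr rfl fun v _ => by ring
  rw [h1, ← one_mul (_ - _), ← P.2.2, Finset.sum_mul]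
  exact Finset.sum_le_sum fun u _ =>
    mul_le_mul_of_nonneg_left (sub_le_sub_left (hw u) _) (P.2.1 u)

/-- Against the pure prediction `w` the two terms cancel, whatever the adversary plays. -/
theorem gameValue_self_le_zero (m : α → α → ℝ) (w : α) :
    gameValue (fun u v => -m u v + m w v) ≤ 0 := by
  classical
  refine gameValue_le ⟨_, single_mem_stdSimplex ℝ w⟩ fun Q => ?_
  refine (Finset.sum_eq_zero fun u _ => Finset.sum_eq_zero fun v _ => ?_).le
  rcases eq_or_ne u w with rfl | hu
  · simp
  · simp [hu]

/-- If `w` is the unique best response to `p` and `p w > 0`, then every `φ` at which the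
surrogate attains its lower bound grows from `y` to `w` at least as much as `m w` does. -/
theorem potential_gap_le (m : α → α → ℝ) (φ : α → ℝ) (p : stdSimplex ℝ α) (w : α)
    (hw : ∀ u, u ≠ w → ∑ v, p.1 v * m u v < ∑ v, p.1 v * m w v) (hpw : 0 < p.1 w)
    (hφ : gameValue (fun u v => -m u v + φ v) - ∑ v, p.1 v * φ v ≤ -∑ v, p.1 v * m w v)
    (y : α) : φ y - φ w ≤ m w y - m w w := by
  classical
  rcases eq_or_ne y w with rfl | hy
  · simp
  -- Strict optimality over finitely many predictions survives a small perturbation, so `w` stays a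
  -- best response to `p + ε(δ_y - δ_w)`.
  have hev : ∀ᶠ ε : ℝ in 𝓝[>] 0, ∀ u,
      ∑ v, p.1 v * m u v + ε * (m u y - m u w) ≤
        ∑ v, p.1 v * m w v + ε * (m w y - m w w) := by
    refine eventually_all.2 fun u => ?_
    rcases eq_or_ne u w with rfl | hu
    · exact Eventually.of_forall fun _ => le_rfl
    have hc : ∀ u, Tendsto (fun ε : ℝ => ∑ v, p.1 v * m u v + ε * (m u y - m u w)) (𝓝[>] 0)
        (𝓝 (∑ v, p.1 v * m u v)) := fun u => by
      have : Continuous fun ε : ℝ => ∑ v, p.1 v * m u v + ε * (m u y - m u w) := by fun_prop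
      simpa using (this.tendsto 0).mono_left nhdsWithin_le_nhds
    exact ((hc u).eventually_lt (hc w) (hw u hu)).mono fun _ h => h.le
  obtain ⟨ε, ⟨hε, hεw⟩, hε0⟩ := ((hev.and (nhdsWithin_le_nhds (Iic_mem_nhds hpw))).and
    self_mem_nhdsWithin).exists
  replace hε0 : 0 < ε := hε0
  replace hεw : ε ≤ p.1 w := hεw
  have hsum : ∀ F : α → ℝ,
      ∑ v, (p.1 v + ε * ((Pi.single y 1 : α → ℝ) v - (Pi.single w 1 : α → ℝ) v)) * F v
        = ∑ v, p.1 v * F v + ε * (F y - F w) := fun F => by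
    simp only [add_mul, mul_assoc, sub_mul, Finset.sum_add_distrib, ← Finset.mul_sum,
      Finset.sum_sub_distrib]
    simp [Pi.single_apply]
  -- Positivity of `p w` enters here: mass `ε ≤ p w` can be taken from `w`.
  have hQ : (fun v => p.1 v + ε * ((Pi.single y 1 : α → ℝ) v - (Pi.single w 1 : α → ℝ) v)) ∈ stdSimplex ℝ α := by
    refine ⟨fun v => ?_, ?_⟩
    · have := p.2.1 v
      rcases eq_or_ne v w with rfl | hv
      · simp [hy.symm, hεw]
      · by_cases hvy : v = y
        · simp only [Pi.single_apply, hvy, hy, if_true, if_false]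
          have := p.2.1 y
          linarith
        · simpa [Pi.single_apply, hv, hvy] using this
    · have := hsum fun _ => 1
      simpa [p.2.2] using this
  have key := le_gameValue_of_best_response m φ ⟨_, hQ⟩ w fun u => by
    simpa only [hsum] using hε u
  simp only [hsum] at key
  have : ε * (φ y - φ w) ≤ ε * (m w y - m w w) := by linarith
  exact le_of_mul_le_mul_left this hε0

end Game

section Risk

theorem advLoss_eq {𝒳 : Type*} {n : ℕ} (m : Labels n → Labels n → ℝ) (h : Potential 𝒳 n) (x : Fin n → 𝒳)
    (y : Labels n) :
    advLoss m h x y = gameValue (fun u v => -m u v + h x v) - h x y :=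
  gameValue_sub_const _ _

variable {𝒳 : Type*} [MeasurableSpace 𝒳] {n : ℕ}

/-- The conditional distribution of the labels as a probability vector. -/
noncomputable def labelDist (P : Kernel (Fin n → 𝒳) (Labels n)) [IsMarkovKernel P]
    (x : Fin n → 𝒳) : stdSimplex ℝ (Labels n) :=
  ⟨fun v => (P x).real {v}, fun _ => measureReal_nonneg, by
    rw [sum_measureReal_singleton]; simp⟩

theorem integral_labels (P : Kernel (Fin n → 𝒳) (Labels n)) [IsMarkovKernel P]
    (x : Fin n → 𝒳) (F : Labels n → ℝ) :
    ∫ y, F y ∂(P x) = ∑ v, (labelDist P x).1 v * F v := by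
  rw [integral_fintype Integrable.of_finite]
  rfl

theorem condRisk_eq (m : Labels n → Labels n → ℝ) (P : Kernel (Fin n → 𝒳) (Labels n))
    [IsMarkovKernel P] (x : Fin n → 𝒳) (h : Potential 𝒳 n) :
    condRisk m P x h = gameValue (fun u v => -m u v + h x v)
      - ∑ v, (labelDist P x).1 v * h x v := by
  simp only [condRisk, advLoss_eq, integral_labels, mul_sub, Finset.sum_sub_distrib,
    ← Finset.sum_mul, (labelDist P x).2.2, one_mul]

theorem mem_bayesOptimal_iff (m : Labels n → Labels n → ℝ) (P : Kernel (Fin n → 𝒳) (Labels n))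
    [IsMarkovKernel P] (x : Fin n → 𝒳) (w : Labels n) :
    w ∈ bayesOptimal m P x ↔
      ∀ u, ∑ v, (labelDist P x).1 v * m u v ≤ ∑ v, (labelDist P x).1 v * m w v := by
  simp only [bayesOptimal, argmaxSet, Set.mem_ofPred_eq, integral_labels]

theorem neg_bayesValue_le_condRisk (m : Labels n → Labels n → ℝ)
    (P : Kernel (Fin n → 𝒳) (Labels n)) [IsMarkovKernel P] (x : Fin n → 𝒳) {w : Labels n}
    (hw : w ∈ bayesOptimal m P x) (h : Potential 𝒳 n) :
    -∑ v, (labelDist P x).1 v * m w v ≤ condRisk m P x h := by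
  have := le_gameValue_of_best_response m (h x) (labelDist P x) w
    ((mem_bayesOptimal_iff m P x w).1 hw)
  rw [condRisk_eq]
  linarith

theorem condRisk_metric_le (m : Labels n → Labels n → ℝ)
    (P : Kernel (Fin n → 𝒳) (Labels n)) [IsMarkovKernel P] (x : Fin n → 𝒳) (w : Labels n) :
    condRisk m P x (fun _ => m w) ≤ -∑ v, (labelDist P x).1 v * m w v := by
  have := gameValue_self_le_zero m w
  rw [condRisk_eq]
  linarith

theorem exists_mem_bayesOptimal (m : Labels n → Labels n → ℝ)
    (P : Kernel (Fin n → 𝒳) (Labels n)) (x : Fin n → 𝒳) : ∃ w, w ∈ bayesOptimal m P x :=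
  Finite.exists_max _

/-- For at least one sample, the metric at a fixed prediction is an additive potential. -/
theorem fracMetric_mem_additivePotentials [NeZero n] {J : Type*} [Fintype J] (a b : J → ℝ)
    (f g : J → ℕ → ℕ → ℝ) (w : Labels n) :
    (fun _ => fracMetric a b f g w) ∈ additivePotentials 𝒳 n := by
  -- With `w` fixed, `TP` and `TN` are sums over samples and `k` stands for `AP`. The term `f j`
  -- belongs to no sample, so each of the `n` samples carries the share `1 / n`; hence `n ≠ 0`.
  refine ⟨fun i k z => ∑ j, (a j * (if w i = true ∧ z.2 = true then 1 else 0)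
    + b j * (if w i = false ∧ z.2 = false then 1 else 0) + f j (numPos w) k / n) /
      g j (numPos w) k, fun i k => ?_, fun x y => ?_⟩
  · exact (measurable_of_finite fun t : Bool =>
      ∑ j, (a j * (if w i = true ∧ t = true then 1 else 0)
        + b j * (if w i = false ∧ t = false then 1 else 0) + f j (numPos w) k / n) /
          g j (numPos w) k).comp measurable_snd
  · have hk : numPos y < n + 1 :=
      Nat.lt_succ_of_le ((Finset.card_le_univ _).trans_eq (Fintype.card_fin n))
    have hn : (n : ℝ) ≠ 0 := Nat.cast_ne_zero.2 (NeZero.ne n)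
    have hsel : ∀ F : Fin (n + 1) → ℝ,
        ∑ k : Fin (n + 1), F k * (if numPos y = (k : ℕ) then 1 else 0) = F ⟨numPos y, hk⟩ := by
      intro F
      rw [Finset.sum_eq_single ⟨numPos y, hk⟩]
      · simp
      · intro k _ hne
        rw [if_neg fun h => hne (Fin.ext h.symm), mul_zero]
      · simp
    simp only [hsel]
    rw [Finset.sum_comm]
    refine Finset.sum_congr rfl fun j _ => ?_
    rw [← Finset.sum_div, Finset.sum_add_distrib, Finset.sum_add_distrib, ← Finset.mul_sum,
      ← Finset.mul_sum, Finset.sum_boole, Finset.sum_boole, Finset.sum_const, Finset.card_univ,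
      Fintype.card_fin, nsmul_eq_mul, mul_div_cancel₀ _ hn]
    rfl

end Risk

end AdversarialPrediction

open AdversarialPrediction in
theorem theorem7 {𝒳 : Type*} [MeasurableSpace 𝒳] {n : ℕ} {J : Type*} [Fintype J]
    (a b : J → ℝ) (f g : J → ℕ → ℕ → ℝ)
    (hmetric : ∀ y y' : Labels n, y' ≠ y → fracMetric a b f g y y' < fracMetric a b f g y y)
    (P : Kernel (Fin n → 𝒳) (Labels n)) [IsMarkovKernel P] (x : Fin n → 𝒳) :
    (∃ h ∈ riskMinimizers (fracMetric a b f g) P (additivePotentials 𝒳 n) x,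
      argmaxSet (h x) ⊆ bayesOptimal (fracMetric a b f g) P x) ∧
    (∀ yopt : Labels n, bayesOptimal (fracMetric a b f g) P x = {yopt} → 0 < P x {yopt} →
      ∀ h ∈ riskMinimizers (fracMetric a b f g) P (additivePotentials 𝒳 n) x,
        argmaxSet (h x) ⊆ bayesOptimal (fracMetric a b f g) P x) := by
  rcases Nat.eq_zero_or_pos n with rfl | hn
  -- Without samples the class contains only the zero potential, so `m w` need not belong to it; but
  -- there is just one label vector.
  · have hall : ∀ s : Set (Labels 0), s ⊆ bayesOptimal (fracMetric a b f g) P x := by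
      obtain ⟨w, hw⟩ := exists_mem_bayesOptimal (fracMetric a b f g) P x
      exact fun s y _ => Subsingleton.elim w y ▸ hw
    refine ⟨⟨fun _ _ => 0, ⟨⟨fun _ _ _ => 0, fun _ _ => measurable_const, by simp⟩, ?_⟩,
      hall _⟩, fun _ _ _ _ _ => hall _⟩
    rintro h' ⟨ρ, -, hρ⟩
    have : h' = fun _ _ => 0 := by
      ext x y
      simp [hρ]
    rw [this]
  have : NeZero n := ⟨hn.ne'⟩
  have hmem := fracMetric_mem_additivePotentials (𝒳 := 𝒳) (n := n) a b f g
  -- From here on only `hmetric` and `hmem` matter, not the form of the metric.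
  generalize fracMetric a b f g = m at *
  refine ⟨?_, fun w hbayes hpos h hh y hy => ?_⟩
  · obtain ⟨w, hw⟩ := exists_mem_bayesOptimal m P x
    refine ⟨fun _ => m w, ⟨hmem w, fun h' _ =>
      (condRisk_metric_le m P x w).trans (neg_bayesValue_le_condRisk m P x hw h')⟩, fun y hy => ?_⟩
    have : y = w := by
      by_contra hne
      exact (hmetric w y hne).not_ge (hy w)
    rwa [this]
  · have hw : w ∈ bayesOptimal m P x := hbayes ▸ rfl
    have hle := (mem_bayesOptimal_iff m P x w).1 hw
    have hlt : ∀ u, u ≠ w →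
        ∑ v, (labelDist P x).1 v * m u v < ∑ v, (labelDist P x).1 v * m w v := by
      refine fun u hu => lt_of_not_ge fun hge => hu ?_
      have : u ∈ bayesOptimal m P x :=
        (mem_bayesOptimal_iff m P x u).2 fun u' => (hle u').trans hge
      rwa [hbayes] at this
    have hrisk := (hh.2 _ (hmem w)).trans (condRisk_metric_le m P x w)
    rw [condRisk_eq] at hrisk
    have hgap := potential_gap_le m (h x) (labelDist P x) w hlt
      (ENNReal.toReal_pos hpos.ne' (measure_ne_top _ _)) hrisk y
    have : y = w := by
      by_contra hne
      have h1 := hmetric w y hne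
      have h2 := hy w
      linarith
    rwa [this]
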